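/- Let $X$ be a connected CW-complex, let $F$ be a field, and let $u\in H^2(X;F)$ be a class in singular cohomology. Call $u$ \emph{aspherical} if $f^*u=0$ in $H^2(S^2;F)$ for every continuous map $f\colon S^2\to X$, and \emph{atoroidal} if $f^*u=0$ in $H^2(T^2;F)$ for every continuous map $f\colon T^2\to X$, where $T^2=(\mathbb{R}/\mathbb{Z})^2$. Assume that $u$ is aspherical and that $\pi_1(X)$ contains no subgroup isomorphic to $\mathbb{Z}^2$. (1) If $F$ has characteristic $0$, then $u$ is atoroidal. (2) If $\pi_1(X)$ is torsion-free, then $u$ is atoroidal, whatever the characteristic of $F$. -/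

import Mathlib

noncomputable section

namespace SingularCohomology

/-- The inclusion of the face of the standard `(n + 1)`-simplex opposite to the vertex `i`. -/
def face (n : ℕ) (i : Fin (n + 2)) :
    C(stdSimplex ℝ (Fin (n + 1)), stdSimplex ℝ (Fin (n + 2))) :=
  ⟨stdSimplex.map i.succAbove, stdSimplex.continuous_map i.succAbove⟩

/-- Singular `n`-simplices of `X`. -/
abbrev Simplex (X : Type*) [TopologicalSpace X] (n : ℕ) : Type _ :=
  C(stdSimplex ℝ (Fin (n + 1)), X)

/-- Singular `n`-cochains of `X` with coefficients in `R`. -/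
abbrev Cochain (R : Type*) (X : Type*) [TopologicalSpace X] (n : ℕ) : Type _ :=
  Simplex X n → R

variable (R : Type*) [CommRing R] (X : Type*) [TopologicalSpace X]

/-- The coboundary `(d c) σ = ∑ i, (-1) ^ i * c (σ ∘ face i)`. -/
def d (n : ℕ) : Cochain R X n →ₗ[R] Cochain R X (n + 1) where
  toFun c σ := ∑ i : Fin (n + 2), (-1 : R) ^ (i : ℕ) * c (σ.comp (face n i))
  map_add' c c' := by
    funext σ
    simp [mul_add, Finset.sum_add_distrib]
  map_smul' a c := by
    funext σ
    simp [Finset.mul_sum, mul_left_comm]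

theorem face_comp_face (n : ℕ) (i : Fin (n + 3)) (j : Fin (n + 2)) :
    (face (n + 1) (i.succAbove j)).comp (face n (j.predAbove i)) =
      (face (n + 1) i).comp (face n j) := by
  ext x : 1
  change stdSimplex.map _ (stdSimplex.map _ x) = stdSimplex.map _ (stdSimplex.map _ x)
  rw [stdSimplex.map_comp_apply, stdSimplex.map_comp_apply]
  congr 1
  funext k
  exact Fin.succAbove_succAbove_succAbove_predAbove i j k

theorem d_d (n : ℕ) (c : Cochain R X n) : d R X (n + 1) (d R X n c) = 0 := by
  funext σ
  change ∑ i : Fin (n + 3), (-1 : R) ^ (i : ℕ) * ∑ j : Fin (n + 2), (-1 : R) ^ (j : ℕ) *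
    c ((σ.comp (face (n + 1) i)).comp (face n j)) = 0
  simp only [Finset.mul_sum]
  rw [← Finset.sum_product']
  refine Finset.sum_involution (fun p _ => (p.1.succAbove p.2, p.2.predAbove p.1)) ?_ ?_ ?_ ?_
  · rintro ⟨i, j⟩ -
    dsimp only
    rw [ContinuousMap.comp_assoc, ContinuousMap.comp_assoc, face_comp_face]
    rcases lt_or_ge j.castSucc i with h | h
    · rw [Fin.succAbove_of_castSucc_lt _ _ h, Fin.predAbove_of_castSucc_lt _ _ h]
      obtain ⟨k, rfl⟩ := Fin.exists_succ_eq.2 (Fin.ne_zero_of_lt h)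
      simp only [Fin.pred_succ, Fin.val_succ, Fin.val_castSucc]
      ring
    · rw [Fin.succAbove_of_le_castSucc _ _ h, Fin.predAbove_of_le_castSucc _ _ h]
      simp only [Fin.val_succ, Fin.coe_castPred]
      ring
  · rintro ⟨i, j⟩ - - h
    exact Fin.succAbove_ne i j (Prod.mk.inj h).1
  · simp
  · rintro ⟨i, j⟩ -
    simp [Fin.succAbove_succAbove_predAbove, Fin.predAbove_predAbove_succAbove]

/-- Singular `n`-cocycles. -/
def cocycles (n : ℕ) : Submodule R (Cochain R X n) := LinearMap.ker (d R X n)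

/-- Singular `n`-coboundaries. -/
def coboundaries : ∀ n : ℕ, Submodule R (Cochain R X n)
  | 0 => ⊥
  | n + 1 => LinearMap.range (d R X n)

/-- The singular cohomology `H^n(X; R)`: cocycles modulo coboundaries. -/
abbrev H (n : ℕ) : Type _ :=
  cocycles R X n ⧸ (coboundaries R X n).comap (cocycles R X n).subtype

variable {X} {Y : Type*} [TopologicalSpace Y]

/-- The cochain map induced by a continuous map, `(f^* c) σ = c (f ∘ σ)`. -/
def cochainPullback (f : C(X, Y)) (n : ℕ) : Cochain R Y n →ₗ[R] Cochain R X n where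
  toFun c σ := c (f.comp σ)
  map_add' _ _ := rfl
  map_smul' _ _ := rfl

theorem d_cochainPullback (f : C(X, Y)) (n : ℕ) (c : Cochain R Y n) :
    d R X n (cochainPullback R f n c) = cochainPullback R f (n + 1) (d R Y n c) := rfl

theorem cochainPullback_mem_cocycles (f : C(X, Y)) (n : ℕ) (c : Cochain R Y n)
    (hc : c ∈ cocycles R Y n) : cochainPullback R f n c ∈ cocycles R X n := by
  have hc' : d R Y n c = 0 := hc
  change d R X n _ = 0
  rw [d_cochainPullback, hc', map_zero]

theorem cochainPullback_mem_coboundaries (f : C(X, Y)) (n : ℕ) (c : Cochain R Y n)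
    (hc : c ∈ coboundaries R Y n) : cochainPullback R f n c ∈ coboundaries R X n := by
  cases n with
  | zero =>
    have hc' : c = 0 := hc
    rw [hc', map_zero]
    exact Submodule.zero_mem _
  | succ n =>
    obtain ⟨b, rfl⟩ := hc
    exact ⟨cochainPullback R f n b, rfl⟩

/-- The induced map `f^* : H^n(Y; R) → H^n(X; R)`, `[c] ↦ [f^* c]`. -/
def pullback (f : C(X, Y)) (n : ℕ) : H R Y n →ₗ[R] H R X n :=
  Submodule.mapQ _ _
    ((cochainPullback R f n).restrict fun c hc => cochainPullback_mem_cocycles R f n c hc)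
    fun c hc => cochainPullback_mem_coboundaries R f n c hc

variable {R} {n : ℕ}

/-- A class `u ∈ H^n(Y; R)` is aspherical if `f^* u = 0` for every continuous `f : S^n → Y`. -/
def IsAspherical (u : H R Y n) : Prop :=
  ∀ f : C(Metric.sphere (0 : EuclideanSpace ℝ (Fin (n + 1))) 1, Y), pullback R f n u = 0

/-- A class `u ∈ H^n(Y; R)` is atoroidal if `f^* u = 0` for every continuous `f : T^n → Y`,
where `T^n = (ℝ / ℤ)^n`. -/
def IsAtoroidal (u : H R Y n) : Prop :=
  ∀ f : C(UnitAddTorus (Fin n), Y), pullback R f n u = 0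

end SingularCohomology

end

noncomputable section
namespace SingularCohomology

/-! Pull a cocycle `c` for `u` back along `f : T² → X` and the covering `ℝ² → T²`. The plane is
contractible, so the pullback is `d b` (`exists_d_eq`), and the question is whether `b` can be made
invariant under `ℤ²`. Each difference of a translate of `b` and `b` itself is exact, so the
circulation of `b` around lattice parallelograms is bilinear and alternating in the sides: it is the
determinant times its value on the unit square (`circulation_eq_det_mul`). That one value is the
only obstruction: if it vanishes, `b` can be corrected to an invariant cochain, which descends to a
primitive on the torus (`exists_d_eq_of_circulation`). Over a field it therefore suffices to find
one lattice parallelogram of nonzero area in `F` and zero circulation.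

Since `π₁(X)` contains no `ℤ²`, the map `ℤ² → π₁(X)` induced by `f` kills some `v ≠ 0`. For every
`w`, the cylinder over the parallelogram of `v` and `w` can then be capped at both ends by the same
null-homotopy, giving a sphere in `X`. Asphericity of `u`, together with cancellation of the two
caps, makes the circulation zero (`circulation_eq_zero_of_nullhomotopy`).

In characteristic zero any `w` independent of `v` will do. If `π₁(X)` is torsion-free, `v` may be
divided by the gcd of its coordinates, and a primitive vector completes to a parallelogram of area
`1`. -/

/-! ### Cones on singular simplices and acyclicity of vector spaces. -/

theorem stdSimplex_map_apply {m n : ℕ} (g : Fin m → Fin n) (x : stdSimplex ℝ (Fin m)) (j : Fin n) :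
    stdSimplex.map g x j = ∑ i with g i = j, x i := by
  change (FunOnFinite.linearMap ℝ ℝ g x) j = _
  rw [FunOnFinite.linearMap_apply_apply]

theorem stdSimplex_map_apply_of_injective {m n : ℕ} {g : Fin m → Fin n} (hg : g.Injective)
    (x : stdSimplex ℝ (Fin m)) (i : Fin m) : stdSimplex.map g x (g i) = x i := by
  rw [stdSimplex_map_apply]
  simp [hg.eq_iff, Finset.filter_eq']

theorem stdSimplex_map_apply_of_notMem {m n : ℕ} {g : Fin m → Fin n}
    (x : stdSimplex ℝ (Fin m)) {j : Fin n} (hj : ∀ i, g i ≠ j) : stdSimplex.map g x j = 0 := by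
  rw [stdSimplex_map_apply]
  simp [hj]

theorem face_apply_succAbove (n : ℕ) (i : Fin (n + 2)) (x : stdSimplex ℝ (Fin (n + 1)))
    (j : Fin (n + 1)) : face n i x (i.succAbove j) = x j :=
  stdSimplex_map_apply_of_injective Fin.succAbove_right_injective x j

theorem face_apply_self (n : ℕ) (i : Fin (n + 2)) (x : stdSimplex ℝ (Fin (n + 1))) :
    face n i x i = 0 :=
  stdSimplex_map_apply_of_notMem x fun _ => Fin.succAbove_ne _ _

/-- The radial projection of a simplex from its vertex `0` onto the opposite face. -/
def radial {n : ℕ} (x : stdSimplex ℝ (Fin (n + 2))) : stdSimplex ℝ (Fin (n + 1)) :=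
  -- The projection is undefined at the apex; the arbitrary value is harmless because `cone`
  -- multiplies it by `1 - x 0 = 0`.
  if h : x 0 = 1 then Classical.arbitrary _ else
    ⟨fun i => x i.succ / (1 - x 0), fun i => div_nonneg (stdSimplex.zero_le x _) (by linarith [stdSimplex.le_one x 0]), by
      have h1 := stdSimplex.sum_eq_one x
      rw [Fin.sum_univ_succ] at h1
      rw [← Finset.sum_div, div_eq_one_iff_eq (sub_ne_zero.2 (Ne.symm h))]
      linarith⟩

theorem radial_apply {n : ℕ} {x : stdSimplex ℝ (Fin (n + 2))} (h : x 0 ≠ 1) (i : Fin (n + 1)) :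
    radial x i = x i.succ / (1 - x 0) := by
  rw [radial, dif_neg h]; rfl

theorem continuous_stdSimplex_apply {n : ℕ} (i : Fin n) :
    Continuous fun x : stdSimplex ℝ (Fin n) => x i :=
  (continuous_apply i).comp continuous_subtype_val

theorem continuousAt_radial {n : ℕ} {x : stdSimplex ℝ (Fin (n + 2))} (h : x 0 ≠ 1) :
    ContinuousAt radial x := by
  rw [Topology.IsInducing.subtypeVal.continuousAt_iff, continuousAt_pi]
  intro i
  have h0 := (continuous_stdSimplex_apply (n := n + 2) 0)
  have : ContinuousAt (fun y : stdSimplex ℝ (Fin (n + 2)) => y i.succ / (1 - y 0)) x :=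
    (continuous_stdSimplex_apply _).continuousAt.div
      (continuous_const.sub h0).continuousAt (sub_ne_zero.2 h.symm)
  refine this.congr ?_
  filter_upwards [h0.continuousAt.eventually_ne h] with y hy
  exact (radial_apply hy i).symm

variable {V : Type*} [NormedAddCommGroup V] [NormedSpace ℝ V]

/-- The cone with apex `0` on a singular simplex of a vector space. -/
def cone {n : ℕ} (σ : Simplex V n) : Simplex V (n + 1) where
  toFun x := (1 - x 0) • σ (radial x)
  continuous_toFun := by
    refine continuous_iff_continuousAt.2 fun x => ?_
    have h0 : Continuous fun x : stdSimplex ℝ (Fin (n + 2)) => 1 - x 0 :=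
      continuous_const.sub (continuous_stdSimplex_apply 0)
    by_cases h : x 0 = 1
    · have h1 := h0.tendsto x
      rw [h, sub_self] at h1
      -- At the apex `radial` has no limit, but `σ` is bounded and the scalar factor tends to zero.
      obtain ⟨C, hC⟩ := (isCompact_range σ.continuous).isBounded.exists_norm_le
      have := h1.zero_smul_isBoundedUnder_le (g := fun y => σ (radial y))
        (Filter.isBoundedUnder_of ⟨C, fun y => hC _ ⟨_, rfl⟩⟩)
      rw [ContinuousAt, h, sub_self, zero_smul]
      exact this
    · exact h0.continuousAt.smul (σ.continuous.continuousAt.comp (continuousAt_radial h))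

theorem cone_comp_face_zero {n : ℕ} (σ : Simplex V n) : (cone σ).comp (face n 0) = σ := by
  ext x
  have h0 : face n 0 x 0 = 0 := face_apply_self n 0 x
  have h1 : radial (face n 0 x) = x := by
    refine stdSimplex.ext (funext fun i => ?_)
    rw [radial_apply (by rw [h0]; exact zero_ne_one), h0, sub_zero, div_one,
      ← Fin.succAbove_zero_apply, face_apply_succAbove]
  change (1 - face n 0 x 0) • σ (radial (face n 0 x)) = σ x
  rw [h0, h1, sub_zero, one_smul]

theorem cone_comp_face_succ {n : ℕ} (σ : Simplex V (n + 1)) (i : Fin (n + 2)) :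
    (cone σ).comp (face (n + 1) i.succ) = cone (σ.comp (face n i)) := by
  ext x
  have h0 : face (n + 1) i.succ x 0 = x 0 := by
    conv_lhs => rw [← Fin.succAbove_ne_zero_zero (Fin.succ_ne_zero i)]
    exact face_apply_succAbove _ _ _ _
  change (1 - face (n + 1) i.succ x 0) • σ (radial (face (n + 1) i.succ x)) =
    (1 - x 0) • σ (face n i (radial x))
  rw [h0]
  by_cases h : x 0 = 1
  · simp [h]
  congr 2
  refine stdSimplex.ext (funext fun j => ?_)
  rw [radial_apply (by rwa [h0]), h0]
  rcases Fin.eq_self_or_eq_succAbove i j with rfl | ⟨k, rfl⟩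
  · rw [face_apply_self, face_apply_self, zero_div]
  · rw [face_apply_succAbove, radial_apply h, ← Fin.succ_succAbove_succ, face_apply_succAbove]

/-- A vector space has no cohomology in positive degrees. -/
theorem exists_d_eq {R : Type*} [CommRing R] {n : ℕ} (c : Cochain R V (n + 1))
    (hc : d R V (n + 1) c = 0) : ∃ b, d R V n b = c := by
  refine ⟨fun σ => c (cone σ), funext fun σ => ?_⟩
  -- Face `0` of the cone is `σ`, the others are cones on the faces of `σ`, with signs shifted by
  -- one.
  have h : ∑ i : Fin (n + 3), (-1 : R) ^ (i : ℕ) * c ((cone σ).comp (face (n + 1) i)) = 0 :=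
    congrFun hc (cone σ)
  rw [Fin.sum_univ_succ, cone_comp_face_zero] at h
  simp only [cone_comp_face_succ, Fin.val_succ, pow_succ] at h
  change ∑ i : Fin (n + 2), (-1 : R) ^ (i : ℕ) * c (cone (σ.comp (face n i))) = c σ
  simp only [mul_neg, mul_one, neg_mul, Finset.sum_neg_distrib, Fin.val_zero, pow_zero, one_mul] at h
  exact (add_neg_eq_zero.1 h).symm

/-! ### The covering of the torus by the plane, and descent of invariant cochains. -/

/-- The universal covering `ℝ² → (ℝ / ℤ)²`. -/
def torusCover : C(ℝ × ℝ, UnitAddTorus (Fin 2)) :=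
  ⟨fun x => ![(x.1 : UnitAddCircle), (x.2 : UnitAddCircle)], by
    refine continuous_pi fun i => ?_
    fin_cases i
    · exact (AddCircle.continuous_mk' 1).comp continuous_fst
    · exact (AddCircle.continuous_mk' 1).comp continuous_snd⟩

/-- The vector of `ℝ²` with integral coordinates `v`. -/
def latticeVec (v : ℤ × ℤ) : ℝ × ℝ := (v.1, v.2)

theorem latticeVec_add (v w : ℤ × ℤ) : latticeVec (v + w) = latticeVec v + latticeVec w := by
  simp [latticeVec]

theorem torusCover_add (v : ℤ × ℤ) (x : ℝ × ℝ) : torusCover (latticeVec v + x) = torusCover x := by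
  have h (k : ℤ) : ((k : ℝ) : UnitAddCircle) = 0 := by
    rw [AddCircle.coe_eq_zero_iff]; exact ⟨k, by simp⟩
  ext i
  fin_cases i <;> simp [torusCover, latticeVec, h]

/-- Translation of the plane by a vector. -/
def shift (a : ℝ × ℝ) : C(ℝ × ℝ, ℝ × ℝ) := ⟨fun x => a + x, by fun_prop⟩

theorem torusCover_comp_shift (v : ℤ × ℤ) : torusCover.comp (shift (latticeVec v)) = torusCover :=
  ContinuousMap.ext fun x => torusCover_add v x

/-- Every map from a simplex to the circle lifts to the line. -/
theorem exists_lift_circle {n : ℕ} (σ : C(stdSimplex ℝ (Fin (n + 1)), UnitAddCircle)) :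
    ∃ s : C(stdSimplex ℝ (Fin (n + 1)), ℝ), ∀ x, (s x : UnitAddCircle) = σ x := by
  have cov : IsCoveringMap ((↑) : ℝ → UnitAddCircle) := AddCircle.isCoveringMap_coe 1
  let a : stdSimplex ℝ (Fin (n + 1)) := Classical.arbitrary _
  -- The straight-line contraction to `a`: lift it from a constant map at time `0` and read off the
  -- lift of `σ` at time `1`.
  let K : C(unitInterval × stdSimplex ℝ (Fin (n + 1)), stdSimplex ℝ (Fin (n + 1))) :=
    ⟨fun p => ⟨(1 - (p.1 : ℝ)) • a.1 + (p.1 : ℝ) • p.2.1,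
      convex_stdSimplex ℝ _ a.2 p.2.2 (by linarith [p.1.2.2]) p.1.2.1 (by ring)⟩, by fun_prop⟩
  obtain ⟨e, he⟩ := QuotientAddGroup.mk_surjective (σ a)
  have h0 : ∀ x, (σ.comp K) (0, x) = ((ContinuousMap.const _ e) x : UnitAddCircle) := fun x => by
    have : K (0, x) = a := Subtype.ext (by simp [K])
    rw [ContinuousMap.comp_apply, this]
    exact he.symm
  refine ⟨(cov.liftHomotopy (σ.comp K) (.const _ e) h0).comp
    ⟨fun x => (1, x), by fun_prop⟩, fun x => ?_⟩
  have h1 := congrFun (cov.liftHomotopy_lifts (σ.comp K) (.const _ e) h0) (1, x)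
  have h2 : K (1, x) = x := Subtype.ext (by simp [K])
  refine h1.trans ?_
  rw [ContinuousMap.comp_apply, h2]

/-- Two lifts of a map from a simplex to the circle differ by an integer. -/
theorem lift_circle_unique {n : ℕ} (s t : C(stdSimplex ℝ (Fin (n + 1)), ℝ))
    (h : ∀ x, (s x : UnitAddCircle) = t x) : ∃ k : ℤ, ∀ x, t x = k + s x := by
  have cov : IsCoveringMap ((↑) : ℝ → UnitAddCircle) := AddCircle.isCoveringMap_coe 1
  let a : stdSimplex ℝ (Fin (n + 1)) := Classical.arbitrary _
  have hk (k : ℤ) : ((k : ℝ) : UnitAddCircle) = 0 := by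
    rw [AddCircle.coe_eq_zero_iff]; exact ⟨k, by simp⟩
  obtain ⟨k, hka⟩ : ∃ k : ℤ, k • (1 : ℝ) = t a - s a := by
    rw [← AddCircle.coe_eq_zero_iff, AddCircle.coe_sub, h, sub_self]
  refine ⟨k, fun x => ?_⟩
  refine congrFun (cov.eq_of_comp_eq (g₁ := t) (g₂ := fun x => k + s x) t.continuous
    (by fun_prop) (funext fun x => ?_) a ?_) x
  · change (t x : UnitAddCircle) = ((k + s x : ℝ) : UnitAddCircle)
    rw [AddCircle.coe_add, hk, zero_add, h]
  · rw [zsmul_eq_mul, mul_one] at hka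
    linarith

theorem exists_lift_torus {n : ℕ} (σ : Simplex (UnitAddTorus (Fin 2)) n) :
    ∃ s : Simplex (ℝ × ℝ) n, torusCover.comp s = σ := by
  obtain ⟨s₀, h₀⟩ := exists_lift_circle (⟨fun x => σ x 0, by fun_prop⟩ : C(_, UnitAddCircle))
  obtain ⟨s₁, h₁⟩ := exists_lift_circle (⟨fun x => σ x 1, by fun_prop⟩ : C(_, UnitAddCircle))
  refine ⟨s₀.prodMk s₁, ?_⟩
  ext x i
  fin_cases i
  · exact h₀ x
  · exact h₁ x

theorem lift_torus_unique {n : ℕ} (s t : Simplex (ℝ × ℝ) n)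
    (h : torusCover.comp s = torusCover.comp t) :
    ∃ v, t = (shift (latticeVec v)).comp s := by
  have h' (x) : torusCover (s x) = torusCover (t x) := DFunLike.congr_fun h x
  obtain ⟨k, hk⟩ := lift_circle_unique (ContinuousMap.fst.comp s) (ContinuousMap.fst.comp t)
    fun x => congrFun (h' x) 0
  obtain ⟨l, hl⟩ := lift_circle_unique (ContinuousMap.snd.comp s) (ContinuousMap.snd.comp t)
    fun x => congrFun (h' x) 1
  exact ⟨(k, l), ContinuousMap.ext fun x => Prod.ext (hk x) (hl x)⟩

variable {R : Type*} [CommRing R]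

/-- A cochain on the torus whose lift is the coboundary of an invariant cochain is a
coboundary. -/
theorem exists_d_eq_of_invariant {n : ℕ} (c : Cochain R (UnitAddTorus (Fin 2)) (n + 1))
    (b : Cochain R (ℝ × ℝ) n) (hb : d R _ n b = cochainPullback R torusCover (n + 1) c)
    (hinv : ∀ v, cochainPullback R (shift (latticeVec v)) n b = b) :
    ∃ b', d R _ n b' = c := by
  -- Lifts differ by lattice translations, so the invariance of `b` makes its value independent of
  -- the lift chosen.
  choose L hL using fun σ : Simplex (UnitAddTorus (Fin 2)) n => exists_lift_torus σ
  have key : cochainPullback R torusCover n (fun σ => b (L σ)) = b := by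
    funext s
    obtain ⟨v, hv⟩ := lift_torus_unique _ _ (hL (torusCover.comp s))
    have := congrFun (hinv v) (L (torusCover.comp s))
    change b ((shift (latticeVec v)).comp (L (torusCover.comp s))) = _ at this
    rw [← hv] at this
    exact this.symm
  refine ⟨fun σ => b (L σ), funext fun σ => ?_⟩
  obtain ⟨s, rfl⟩ := exists_lift_torus σ
  have h := congrFun (d_cochainPullback R torusCover n (fun σ => b (L σ))) s
  rw [key, hb] at h
  exact h.symm


/-! ### Edges, translations and circulation. -/

/-- The singular `n`-simplex that is constant at a point. -/
abbrev pt {Y : Type*} [TopologicalSpace Y] (n : ℕ) (y : Y) : Simplex Y n := ContinuousMap.const _ y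

theorem eq_pt {Y : Type*} [TopologicalSpace Y] (σ : Simplex Y 0) : σ = pt 0 (σ default) :=
  ContinuousMap.ext fun _ => congrArg σ (Subsingleton.elim _ _)

/-- The segment from `x` to `y` as a singular `1`-simplex of the plane. -/
def edge (x y : ℝ × ℝ) : Simplex (ℝ × ℝ) 1 :=
  ⟨fun t => t.1 0 • x + t.1 1 • y, ((continuous_stdSimplex_apply 0).smul continuous_const).add
    ((continuous_stdSimplex_apply 1).smul continuous_const)⟩

theorem edge_comp_face_zero (x y : ℝ × ℝ) : (edge x y).comp (face 0 0) = pt 0 y := by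
  ext1 t
  have h0 : face 0 0 t 0 = 0 := face_apply_self 0 0 t
  have h1 : face 0 0 t 1 = 1 := by
    have := stdSimplex.sum_eq_one (face 0 0 t)
    rwa [Fin.sum_univ_two, h0, zero_add] at this
  change (face 0 0 t 0) • x + (face 0 0 t 1) • y = y
  rw [h0, h1, zero_smul, one_smul, zero_add]

theorem edge_comp_face_one (x y : ℝ × ℝ) : (edge x y).comp (face 0 1) = pt 0 x := by
  ext1 t
  have h1 : face 0 1 t 1 = 0 := face_apply_self 0 1 t
  have h0 : face 0 1 t 0 = 1 := by
    have := stdSimplex.sum_eq_one (face 0 1 t)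
    rwa [Fin.sum_univ_two, h1, add_zero] at this
  change (face 0 1 t 0) • x + (face 0 1 t 1) • y = x
  rw [h0, h1, zero_smul, one_smul, add_zero]

theorem shift_comp_edge (a x y : ℝ × ℝ) : (shift a).comp (edge x y) = edge (a + x) (a + y) := by
  ext1 t
  have h : t.1 0 + t.1 1 = 1 := by
    have := stdSimplex.sum_eq_one t
    rwa [Fin.sum_univ_two] at this
  change a + (t.1 0 • x + t.1 1 • y) = t.1 0 • (a + x) + t.1 1 • (a + y)
  have : a = (t.1 0 + t.1 1) • a := by rw [h, one_smul]
  conv_lhs => rw [this]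
  module

theorem d_edge (h : Cochain R (ℝ × ℝ) 0) (x y : ℝ × ℝ) :
    d R _ 0 h (edge x y) = h (pt 0 y) - h (pt 0 x) := by
  change ∑ i : Fin 2, (-1 : R) ^ (i : ℕ) * h ((edge x y).comp (face 0 i)) = _
  rw [Fin.sum_univ_two, edge_comp_face_zero, edge_comp_face_one]
  simp [sub_eq_add_neg]

/-- The translate of a cochain of the plane by an integral vector. -/
abbrev translate (R : Type*) [CommRing R] (v : ℤ × ℤ) (n : ℕ) :
    Cochain R (ℝ × ℝ) n →ₗ[R] Cochain R (ℝ × ℝ) n :=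
  cochainPullback R (shift (latticeVec v)) n

theorem translate_translate (v w : ℤ × ℤ) {n : ℕ} (b : Cochain R (ℝ × ℝ) n) :
    translate R v n (translate R w n b) = translate R (w + v) n b := by
  funext σ
  refine congrArg b (ContinuousMap.ext fun x => ?_)
  change latticeVec w + (latticeVec v + σ x) = latticeVec (w + v) + σ x
  rw [latticeVec_add, add_assoc]

theorem translate_apply_pt (v : ℤ × ℤ) (h : Cochain R (ℝ × ℝ) 0) (x : ℝ × ℝ) :
    translate R v 0 h (pt 0 x) = h (pt 0 (latticeVec v + x)) := rfl

omit [CommRing R] in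
theorem cochain_zero_ext {h k : Cochain R (ℝ × ℝ) 0} (H : ∀ x, h (pt 0 x) = k (pt 0 x)) :
    h = k := by
  funext σ
  rw [eq_pt σ]
  exact H _

/-- The integral of a `1`-cochain along the boundary of the parallelogram spanned by `v`, `w`. -/
def circulation (b : Cochain R (ℝ × ℝ) 1) (v w : ℝ × ℝ) : R :=
  b (edge 0 v) + b (edge v (v + w)) - b (edge w (v + w)) - b (edge 0 w)

theorem circulation_self (b : Cochain R (ℝ × ℝ) 1) (v : ℝ × ℝ) : circulation b v v = 0 := by
  simp [circulation]

theorem circulation_swap (b : Cochain R (ℝ × ℝ) 1) (v w : ℝ × ℝ) :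
    circulation b w v = -circulation b v w := by
  simp only [circulation, add_comm w v]
  ring

/-- A closed `b` is exact on the plane, and the vertex values of its primitive cancel around the
parallelogram. -/
theorem circulation_eq_zero {b : Cochain R (ℝ × ℝ) 1} (hb : d R _ 1 b = 0) (v w : ℝ × ℝ) :
    circulation b v w = 0 := by
  obtain ⟨h, rfl⟩ := exists_d_eq b hb
  simp only [circulation, d_edge]
  ring

/-! ### Bilinearity of the circulation on the lattice. -/

section Periods

variable {b : Cochain R (ℝ × ℝ) 1}

/-- The `1`-cochain `b` has `h` as a primitive of its increment under translation by `v`. -/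
def IsIncrement (b : Cochain R (ℝ × ℝ) 1) (v : ℤ × ℤ) (h : Cochain R (ℝ × ℝ) 0) : Prop :=
  d R _ 0 h = translate R v 1 b - b

theorem IsIncrement.sub_eq {v : ℤ × ℤ} {h : Cochain R (ℝ × ℝ) 0} (H : IsIncrement b v h)
    (x y : ℝ × ℝ) : h (pt 0 y) - h (pt 0 x) =
      b (edge (latticeVec v + x) (latticeVec v + y)) - b (edge x y) := by
  rw [← d_edge, H, Pi.sub_apply, ← shift_comp_edge]
  rfl

/-- The left side seems to depend on `x`, but moving `x` changes both differences by the same values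
of `b`. This freedom of base point is what makes the circulation additive. -/
theorem IsIncrement.circulation_eq {v w : ℤ × ℤ} {h k : Cochain R (ℝ × ℝ) 0}
    (hv : IsIncrement b v h) (hw : IsIncrement b w k) (x : ℝ × ℝ) :
    h (pt 0 (latticeVec w + x)) - h (pt 0 x) - (k (pt 0 (latticeVec v + x)) - k (pt 0 x)) =
      circulation b (latticeVec v) (latticeVec w) := by
  have h1 := hv.sub_eq (latticeVec w) (latticeVec w + x)
  have h2 := hv.sub_eq 0 x
  have h3 := hw.sub_eq (latticeVec v) (latticeVec v + x)
  have h4 := hw.sub_eq 0 x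
  have h5 := hv.sub_eq 0 (latticeVec w)
  have h6 := hw.sub_eq 0 (latticeVec v)
  rw [add_zero] at h2 h4 h5 h6
  rw [add_comm (latticeVec w) (latticeVec v)] at h6
  rw [add_left_comm (latticeVec w), add_comm (latticeVec w) (latticeVec v)] at h3
  rw [circulation]
  linear_combination h1 - h2 - h3 + h4 + h5 - h6

theorem IsIncrement.add {v w : ℤ × ℤ} {h k : Cochain R (ℝ × ℝ) 0}
    (hv : IsIncrement b v h) (hw : IsIncrement b w k) :
    IsIncrement b (v + w) (h + translate R v 0 k) := by
  have hv' : d R _ 0 h = translate R v 1 b - b := hv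
  have hw' : d R _ 0 k = translate R w 1 b - b := hw
  change d R _ 0 (h + translate R v 0 k) = _
  rw [map_add, d_cochainPullback, hv', hw', map_sub, translate_translate, add_comm w v]
  abel

variable (H : ∀ v, ∃ h, IsIncrement b v h)
include H

theorem circulation_add (u v w : ℤ × ℤ) : circulation b (latticeVec (u + v)) (latticeVec w) =
    circulation b (latticeVec u) (latticeVec w) + circulation b (latticeVec v) (latticeVec w) := by
  obtain ⟨h, hu⟩ := H u
  obtain ⟨k, hv⟩ := H v
  obtain ⟨l, hw⟩ := H w
  -- The last base point is moved to `u`, matching the translate of `k` by `u` in the increment for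
  -- `u + v`.
  rw [← (hu.add hv).circulation_eq hw 0, ← hu.circulation_eq hw 0,
    ← hv.circulation_eq hw (latticeVec u + 0)]
  simp only [Pi.add_apply, translate_apply_pt, latticeVec_add]
  rw [add_left_comm (latticeVec w) (latticeVec u) 0, ← add_assoc (latticeVec v) (latticeVec u) 0,
    add_comm (latticeVec v) (latticeVec u)]
  ring

/-- The circulation as an additive function of the first period. -/
def circulationHom (w : ℤ × ℤ) : ℤ × ℤ →+ R :=
  AddMonoidHom.mk' (fun v => circulation b (latticeVec v) (latticeVec w)) fun u v =>
    circulation_add H u v w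

theorem circulation_expand (v w : ℤ × ℤ) : circulation b (latticeVec v) (latticeVec w) =
    v.1 * circulation b (latticeVec (1, 0)) (latticeVec w) +
      v.2 * circulation b (latticeVec (0, 1)) (latticeVec w) := by
  have h : v = v.1 • ((1, 0) : ℤ × ℤ) + v.2 • ((0, 1) : ℤ × ℤ) := by ext <;> simp
  have h2 := congrArg (circulationHom H w) h
  rw [map_add, map_zsmul, map_zsmul, zsmul_eq_mul, zsmul_eq_mul] at h2
  exact h2

theorem circulation_eq_det_mul (v w : ℤ × ℤ) : circulation b (latticeVec v) (latticeVec w) =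
    (v.1 * w.2 - v.2 * w.1) * circulation b (latticeVec (1, 0)) (latticeVec (0, 1)) := by
  have h1 := circulation_expand H v w
  have h2 := circulation_swap b (latticeVec w) (latticeVec (1, 0))
  have h3 := circulation_swap b (latticeVec w) (latticeVec (0, 1))
  rw [circulation_expand H w, circulation_self] at h2 h3
  rw [circulation_swap b (latticeVec (1, 0)) (latticeVec (0, 1))] at h2
  linear_combination h1 + v.1 * h2 + v.2 * h3

end Periods

/-! ### Correcting a primitive to an invariant one. -/

section Correction

theorem exists_sub_eq (a : ℤ → R) : ∃ k : ℤ → R, ∀ m, k (m + 1) - k m = a m := by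
  refine ⟨fun m => ∑ i ∈ Finset.Ico 0 m, a i - ∑ i ∈ Finset.Ico m 0, a i, fun m => ?_⟩
  dsimp only
  rcases le_or_gt 0 m with h | h
  · have h1 : Finset.Ico 0 (m + 1) = insert m (Finset.Ico 0 m) := by
      ext; simp only [Finset.mem_Ico, Finset.mem_insert]; lia
    rw [h1, Finset.sum_insert (by simp), Finset.Ico_eq_empty (a := m) (by lia),
      Finset.Ico_eq_empty (a := m + 1) (by lia)]
    simp
  · have h1 : Finset.Ico m 0 = insert m (Finset.Ico (m + 1) 0) := by
      ext; simp only [Finset.mem_Ico, Finset.mem_insert]; lia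
    rw [h1, Finset.sum_insert (by simp), Finset.Ico_eq_empty (b := m) (by lia),
      Finset.Ico_eq_empty (b := m + 1) (by lia)]
    simp

/-- Each coset of `ℤ` in `ℝ` is treated separately, starting from its fractional part; no continuity
is required of a cochain. The second clause lets the solution inherit periodicity in the parameter.
-/
theorem exists_sub_eq_fun {A : Type*} (h : A → ℝ → R) :
    ∃ k : A → ℝ → R, (∀ a x, k a (1 + x) - k a x = h a x) ∧ ∀ a a', h a = h a' → k a = k a' := by
  choose K hK using exists_sub_eq (R := R)
  refine ⟨fun a x => K (fun m => h a (m + Int.fract x)) ⌊x⌋, fun a x => ?_, fun a a' e => ?_⟩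
  · dsimp only
    rw [add_comm, Int.fract_add_one, Int.floor_add_one, hK, Int.floor_add_fract]
  · simp only [e]

/-- A `0`-cochain from a function on points. -/
def ofFun (k : ℝ × ℝ → R) : Cochain R (ℝ × ℝ) 0 := fun σ => k (σ default)

theorem translate_eq_of_generators {n : ℕ} {b : Cochain R (ℝ × ℝ) n}
    (h1 : translate R (1, 0) n b = b) (h2 : translate R (0, 1) n b = b) (v : ℤ × ℤ) :
    translate R v n b = b := by
  let S : AddSubgroup (ℤ × ℤ) :=
    { carrier := {v | translate R v n b = b}
      zero_mem' := by
        funext σ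
        refine congrArg b (ContinuousMap.ext fun x => ?_)
        change latticeVec 0 + σ x = σ x
        simp [latticeVec]
      add_mem' := fun {v w} hv hw => by
        change translate R (v + w) n b = b
        rw [← translate_translate, hv, hw]
      neg_mem' := fun {v} hv => by
        change translate R (-v) n b = b
        have h : translate R v n b = b := hv
        conv_lhs => rw [← h]
        rw [translate_translate, add_neg_cancel]
        funext σ
        refine congrArg b (ContinuousMap.ext fun x => ?_)
        change latticeVec 0 + σ x = σ x
        simp [latticeVec] }
  have h : v = v.1 • ((1, 0) : ℤ × ℤ) + v.2 • ((0, 1) : ℤ × ℤ) := by ext <;> simp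
  rw [h]
  exact S.add_mem (S.zsmul_mem h1 _) (S.zsmul_mem h2 _)

/-- A cochain pulled back from the torus is invariant, so the increment of `b` is closed, hence
exact on the plane. -/
theorem exists_isIncrement {c : Cochain R (UnitAddTorus (Fin 2)) 2} {b : Cochain R (ℝ × ℝ) 1}
    (hb : d R _ 1 b = cochainPullback R torusCover 2 c) (v : ℤ × ℤ) : ∃ h, IsIncrement b v h := by
  refine exists_d_eq _ ?_
  rw [map_sub, d_cochainPullback, hb, sub_eq_zero]
  funext σ
  refine congrArg c ?_
  rw [← ContinuousMap.comp_assoc, torusCover_comp_shift]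

/-- Subtracting `d k`, where `k` has horizontal increment `h`, makes `b` invariant horizontally. The
remaining vertical increment is removed by `d m`, where `m` must be horizontally periodic so as not
to spoil the first correction. -/
theorem exists_d_eq_of_circulation {c : Cochain R (UnitAddTorus (Fin 2)) 2}
    {b : Cochain R (ℝ × ℝ) 1} (hb : d R _ 1 b = cochainPullback R torusCover 2 c)
    (h0 : circulation b (latticeVec (1, 0)) (latticeVec (0, 1)) = 0) : ∃ b', d R _ 1 b' = c := by
  obtain ⟨h, hh⟩ := exists_isIncrement hb (1, 0)
  obtain ⟨l, hl⟩ := exists_isIncrement hb (0, 1)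
  have e1 (x y : ℝ) : latticeVec (1, 0) + (x, y) = (1 + x, y) := by simp [latticeVec]
  have e2 (x y : ℝ) : latticeVec (0, 1) + (x, y) = (x, 1 + y) := by simp [latticeVec]
  obtain ⟨k, hk, -⟩ := exists_sub_eq_fun fun y x => h (pt 0 (x, y))
  obtain ⟨m, hm, hm'⟩ := exists_sub_eq_fun fun x y => l (pt 0 (x, y)) - (k (1 + y) x - k y x)
  -- Zero circulation says exactly that the remaining vertical increment is 1-periodic in `x`.
  have hper (x : ℝ) : m (1 + x) = m x := by
    refine hm' _ _ (funext fun y => ?_)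
    have := hh.circulation_eq hl (x, y)
    rw [h0, e1, e2] at this
    linear_combination hk y x - hk (1 + y) x - this
  have hh' : d R _ 0 h = translate R (1, 0) 1 b - b := hh
  have hl' : d R _ 0 l = translate R (0, 1) 1 b - b := hl
  have hk1 : translate R (1, 0) 0 (ofFun fun x => k x.2 x.1) - ofFun (fun x => k x.2 x.1) = h := by
    refine cochain_zero_ext fun ⟨x, y⟩ => ?_
    rw [Pi.sub_apply, translate_apply_pt, e1]
    exact hk y x
  have hm1 : translate R (1, 0) 0 (ofFun fun x => m x.1 x.2) = ofFun (fun x => m x.1 x.2) := by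
    refine cochain_zero_ext fun ⟨x, y⟩ => ?_
    rw [translate_apply_pt, e1]
    exact congrFun (hper x) y
  have hm2 : translate R (0, 1) 0 (ofFun fun x => m x.1 x.2) - ofFun (fun x => m x.1 x.2) =
      l - (translate R (0, 1) 0 (ofFun fun x => k x.2 x.1) - ofFun (fun x => k x.2 x.1)) := by
    refine cochain_zero_ext fun ⟨x, y⟩ => ?_
    simp only [Pi.sub_apply, translate_apply_pt, e2]
    exact hm x y
  refine exists_d_eq_of_invariant c (b - d R _ 0 (ofFun fun x => k x.2 x.1) -
    d R _ 0 (ofFun fun x => m x.1 x.2)) ?_ (translate_eq_of_generators ?_ ?_)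
  · rw [map_sub, map_sub, d_d, d_d, sub_zero, sub_zero, hb]
  · rw [map_sub, map_sub, ← d_cochainPullback, ← d_cochainPullback, hm1,
      eq_add_of_sub_eq hk1, map_add, hh']
    abel
  · rw [map_sub, map_sub, ← d_cochainPullback, ← d_cochainPullback,
      eq_add_of_sub_eq hm2, map_add, map_sub, map_sub, hl']
    abel

end Correction

/-- A `2`-cocycle on the torus is a coboundary if its primitive on the plane has circulation zero
along some parallelogram with integral sides and invertible area. -/
theorem exists_d_eq_of_det_ne_zero {F : Type*} [Field F]
    {c : Cochain F (UnitAddTorus (Fin 2)) 2}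
    {b : Cochain F (ℝ × ℝ) 1} (hb : d F _ 1 b = cochainPullback F torusCover 2 c) (v w : ℤ × ℤ)
    (hvw : (v.1 * w.2 - v.2 * w.1 : F) ≠ 0)
    (h0 : circulation b (latticeVec v) (latticeVec w) = 0) : ∃ b', d F _ 1 b' = c := by
  rw [circulation_eq_det_mul (exists_isIncrement hb)] at h0
  exact exists_d_eq_of_circulation hb ((mul_eq_zero.1 h0).resolve_left hvw)


/-! ### The sphere as a quotient of the square. -/

section Sphere

open unitInterval

/-- The unit sphere of three-dimensional space. -/
abbrev S2 : Type := Metric.sphere (0 : EuclideanSpace ℝ (Fin (2 + 1))) 1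

/-- Spherical coordinates: `s` is the longitude and `t` the colatitude. -/
def spherical : C(ℝ × ℝ, S2) where
  toFun p := ⟨!₂[Real.sin (Real.pi * p.2) * Real.cos (2 * Real.pi * p.1),
      Real.sin (Real.pi * p.2) * Real.sin (2 * Real.pi * p.1), Real.cos (Real.pi * p.2)], by
    rw [mem_sphere_zero_iff_norm, EuclideanSpace.norm_eq, Real.sqrt_eq_one, Fin.sum_univ_three]
    simp only [Real.norm_eq_abs, sq_abs]
    change (Real.sin (Real.pi * p.2) * Real.cos (2 * Real.pi * p.1)) ^ 2 +
      (Real.sin (Real.pi * p.2) * Real.sin (2 * Real.pi * p.1)) ^ 2 +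
      Real.cos (Real.pi * p.2) ^ 2 = 1
    linear_combination Real.sin (Real.pi * p.2) ^ 2 * Real.sin_sq_add_cos_sq (2 * Real.pi * p.1) +
      Real.sin_sq_add_cos_sq (Real.pi * p.2)⟩
  continuous_toFun := by
    refine Continuous.subtype_mk ((PiLp.continuous_toLp 2 _).comp (continuous_pi fun i => ?_)) _
    fin_cases i <;> simp <;> fun_prop

theorem spherical_apply_eq {p : ℝ × ℝ} {y : S2}
    (h0 : Real.sin (Real.pi * p.2) * Real.cos (2 * Real.pi * p.1) = y.1 0)
    (h1 : Real.sin (Real.pi * p.2) * Real.sin (2 * Real.pi * p.1) = y.1 1)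
    (h2 : Real.cos (Real.pi * p.2) = y.1 2) : spherical p = y := by
  refine Subtype.ext (PiLp.ext fun i => ?_)
  fin_cases i
  exacts [h0, h1, h2]

theorem spherical_add_one (s t : ℝ) : spherical (s + 1, t) = spherical (s, t) := by
  have h : 2 * Real.pi * (s + 1) = 2 * Real.pi * s + 2 * Real.pi := by ring
  apply spherical_apply_eq
  · dsimp only; rw [h, Real.cos_add_two_pi]; rfl
  · dsimp only; rw [h, Real.sin_add_two_pi]; rfl
  · rfl

theorem spherical_zero (s : ℝ) : spherical (s, 0) = spherical (0, 0) := by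
  apply spherical_apply_eq
  · change _ = Real.sin (Real.pi * 0) * _; simp
  · change _ = Real.sin (Real.pi * 0) * _; simp
  · rfl

theorem spherical_one (s : ℝ) : spherical (s, 1) = spherical (0, 1) := by
  apply spherical_apply_eq
  · change _ = Real.sin (Real.pi * 1) * _; simp
  · change _ = Real.sin (Real.pi * 1) * _; simp
  · rfl

/-- Spherical coordinates on the unit square. -/
def sphericalSquare : C(I × I, S2) :=
  spherical.comp ⟨fun p => (p.1, p.2), by fun_prop⟩

theorem exists_polar (x y : ℝ) : ∃ s : I,
    √(x ^ 2 + y ^ 2) * Real.cos (2 * Real.pi * s) = x ∧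
    √(x ^ 2 + y ^ 2) * Real.sin (2 * Real.pi * s) = y := by
  let z : ℂ := ⟨x, y⟩
  have hn : ‖z‖ = √(x ^ 2 + y ^ 2) := by rw [Complex.norm_eq_sqrt_sq_add_sq]
  have h : 2 * Real.pi * Int.fract (z.arg / (2 * Real.pi)) =
      z.arg - ⌊z.arg / (2 * Real.pi)⌋ * (2 * Real.pi) := by
    rw [Int.fract]
    field_simp
  refine ⟨⟨Int.fract (z.arg / (2 * Real.pi)), Int.fract_nonneg _, (Int.fract_lt_one _).le⟩, ?_, ?_⟩
  · rw [h, Real.cos_sub_int_mul_two_pi, ← hn]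
    exact Complex.norm_mul_cos_arg z
  · rw [h, Real.sin_sub_int_mul_two_pi, ← hn]
    exact Complex.norm_mul_sin_arg z

theorem sphericalSquare_surjective : Function.Surjective sphericalSquare := by
  intro y
  have hy : y.1 0 ^ 2 + y.1 1 ^ 2 + y.1 2 ^ 2 = 1 := by
    have h := y.2
    rw [mem_sphere_zero_iff_norm, EuclideanSpace.norm_eq, Real.sqrt_eq_one,
      Fin.sum_univ_three] at h
    simpa only [Real.norm_eq_abs, sq_abs] using h
  obtain ⟨s, h0, h1⟩ := exists_polar (y.1 0) (y.1 1)
  have ht : Real.pi * (Real.arccos (y.1 2) / Real.pi) = Real.arccos (y.1 2) := by field_simp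
  have hs : √(y.1 0 ^ 2 + y.1 1 ^ 2) = Real.sin (Real.arccos (y.1 2)) := by
    rw [Real.sin_arccos]
    congr 1
    linarith
  refine ⟨(s, ⟨Real.arccos (y.1 2) / Real.pi, div_nonneg (Real.arccos_nonneg _) Real.pi_pos.le,
    div_le_one_of_le₀ (Real.arccos_le_pi _) Real.pi_pos.le⟩), spherical_apply_eq ?_ ?_ ?_⟩
  · dsimp; rw [ht, ← hs, h0]
  · dsimp; rw [ht, ← hs, h1]
  · dsimp; rw [ht]
    exact Real.cos_arccos (by nlinarith [sq_nonneg (y.1 0), sq_nonneg (y.1 1)])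
      (by nlinarith [sq_nonneg (y.1 0), sq_nonneg (y.1 1)])

theorem eq_of_sphericalSquare_eq {s s' t t' : I}
    (h : sphericalSquare (s, t) = sphericalSquare (s', t')) :
    t = t' ∧ (t = 0 ∨ t = 1 ∨ s = s' ∨ s = 0 ∧ s' = 1 ∨ s = 1 ∧ s' = 0) := by
  have hi (i : Fin 3) := congrArg (fun y : S2 => y.1 i) h
  have h0 : Real.sin (Real.pi * t) * Real.cos (2 * Real.pi * s) =
    Real.sin (Real.pi * t') * Real.cos (2 * Real.pi * s') := hi 0
  have h1 : Real.sin (Real.pi * t) * Real.sin (2 * Real.pi * s) =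
    Real.sin (Real.pi * t') * Real.sin (2 * Real.pi * s') := hi 1
  have h2 : Real.cos (Real.pi * t) = Real.cos (Real.pi * t') := hi 2
  have hpi := Real.pi_pos
  have hm (r : I) : Real.pi * r ∈ Set.Icc 0 Real.pi :=
    ⟨mul_nonneg hpi.le r.2.1, mul_le_of_le_one_right hpi.le r.2.2⟩
  have htt : t = t' :=
    Subtype.ext (mul_left_cancel₀ hpi.ne' (Real.injOn_cos (hm t) (hm t') h2))
  subst htt
  refine ⟨rfl, ?_⟩
  by_cases t0 : t = 0
  · exact .inl t0
  by_cases t1 : t = 1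
  · exact .inr (.inl t1)
  have hs : Real.sin (Real.pi * t) ≠ 0 := by
    refine (Real.sin_pos_of_pos_of_lt_pi (mul_pos hpi (unitInterval.pos_iff_ne_zero.2 t0))
      (mul_lt_of_lt_one_right hpi (unitInterval.lt_one_iff_ne_one.2 t1))).ne'
  have e := Real.Angle.cos_sin_inj (mul_left_cancel₀ hs h0) (mul_left_cancel₀ hs h1)
  obtain ⟨k, hk⟩ := Real.Angle.angle_eq_iff_two_pi_dvd_sub.1 e
  have hk' : (s : ℝ) - s' = k := by
    have : (2 * Real.pi) * ((s : ℝ) - s') = 2 * Real.pi * k := by linarith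
    exact mul_left_cancel₀ (by positivity) this
  have l1 : (k : ℝ) ≤ 1 := by linarith [s.2.2, s'.2.1]
  have l2 : (-1 : ℝ) ≤ k := by linarith [s.2.1, s'.2.2]
  have l1' : k ≤ 1 := by exact_mod_cast l1
  have l2' : -1 ≤ k := by exact_mod_cast l2
  have hcase : k = -1 ∨ k = 0 ∨ k = 1 := by lia
  right; right
  rcases hcase with rfl | rfl | rfl
  · right; left
    push_cast at hk'
    exact ⟨Subtype.ext (by change (s : ℝ) = 0; linarith [s.2.1, s'.2.2]),
      Subtype.ext (by change (s' : ℝ) = 1; linarith [s.2.1, s'.2.2])⟩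
  · left
    push_cast at hk'
    exact Subtype.ext (by linarith)
  · right; right
    push_cast at hk'
    exact ⟨Subtype.ext (by change (s : ℝ) = 1; linarith [s.2.2, s'.2.1]),
      Subtype.ext (by change (s' : ℝ) = 0; linarith [s.2.2, s'.2.1])⟩

/-- A map of the square that identifies the vertical sides and collapses the horizontal ones
descends to the sphere. -/
theorem exists_descend_sphere {X : Type*} [TopologicalSpace X] (G : C(I × I, X))
    (hv : ∀ t, G (0, t) = G (1, t)) (h0 : ∀ s, G (s, 0) = G (0, 0))
    (h1 : ∀ s, G (s, 1) = G (0, 1)) : ∃ g : C(S2, X), ∀ p, g (sphericalSquare p) = G p := by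
  -- A continuous surjection from a compact space to a Hausdorff space is closed, hence a quotient
  -- map.
  have hq : Topology.IsQuotientMap sphericalSquare :=
    sphericalSquare.continuous.isClosedMap.isQuotientMap sphericalSquare.continuous
      sphericalSquare_surjective
  have hG : ∀ p q, sphericalSquare p = sphericalSquare q → G p = G q := by
    rintro ⟨s, t⟩ ⟨s', t'⟩ h
    obtain ⟨rfl, h'⟩ := eq_of_sphericalSquare_eq h
    clear h
    rcases h' with rfl | rfl | rfl | ⟨rfl, rfl⟩ | ⟨rfl, rfl⟩
    · rw [h0, h0 s']
    · rw [h1, h1 s']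
    · rfl
    · exact hv t
    · exact (hv t).symm
  exact ⟨hq.lift G hG, fun p => DFunLike.congr_fun (hq.lift_comp G hG) p⟩

end Sphere

/-! ### Capping a cylinder to a sphere. -/

section Gluing

open unitInterval

variable {X : Type*} [TopologicalSpace X] {R : Type*} [CommRing R]

/-- The retraction of the line onto the unit interval. -/
abbrev clamp (x : ℝ) : I := Set.projIcc 0 1 zero_le_one x

theorem continuous_clamp : Continuous clamp := continuous_projIcc

theorem clamp_coe {x : ℝ} (hx : x ∈ I) : clamp x = ⟨x, hx⟩ := Set.projIcc_of_mem _ hx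

/-- The retraction of the plane onto the unit square, followed by the affine map
`(s, t) ↦ (s, a + ε * t)`. -/
def squareMap (a ε : ℝ) : C(ℝ × ℝ, ℝ × ℝ) :=
  ⟨fun p => (clamp p.1, a + ε * clamp p.2), by
    have := continuous_clamp
    fun_prop⟩

theorem squareMap_comp_edge (a ε : ℝ) {x y : ℝ × ℝ} (hx : x.1 ∈ I ∧ x.2 ∈ I)
    (hy : y.1 ∈ I ∧ y.2 ∈ I) : (squareMap a ε).comp (edge x y) =
      edge (x.1, a + ε * x.2) (y.1, a + ε * y.2) := by
  ext1 t
  have h := stdSimplex.sum_eq_one t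
  rw [Fin.sum_univ_two] at h
  have h1 : t 0 * x.1 + t 1 * y.1 ∈ I :=
    convex_Icc 0 1 hx.1 hy.1 (stdSimplex.zero_le t 0) (stdSimplex.zero_le t 1) h
  have h2 : t 0 * x.2 + t 1 * y.2 ∈ I :=
    convex_Icc 0 1 hx.2 hy.2 (stdSimplex.zero_le t 0) (stdSimplex.zero_le t 1) h
  change ((clamp (t 0 * x.1 + t 1 * y.1) : ℝ), a + ε * (clamp (t 0 * x.2 + t 1 * y.2) : ℝ)) =
    (t 0 * x.1 + t 1 * y.1, t 0 * (a + ε * x.2) + t 1 * (a + ε * y.2))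
  rw [clamp_coe h1, clamp_coe h2]
  refine Prod.ext rfl ?_
  change a + ε * (t 0 * x.2 + t 1 * y.2) = t 0 * (a + ε * x.2) + t 1 * (a + ε * y.2)
  linear_combination -a * h

/-- The three faces of a constant 2-simplex coincide and carry signs `1 - 1 + 1 = 1`. So the value
of `b` at a constant 1-simplex does not depend on the choice of primitive. -/
theorem apply_pt_of_d_eq {Y : Type*} [TopologicalSpace Y] {b : Cochain R Y 1} {c : Cochain R Y 2}
    (h : d R Y 1 b = c) (y : Y) : b (pt 1 y) = c (pt 2 y) := by
  rw [← h]
  change _ = ∑ i : Fin 3, (-1 : R) ^ (i : ℕ) * b (pt 1 y)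
  rw [Fin.sum_univ_three]
  simp

/-- Two maps of the unit square that agree there after composition with `Φ` and `Ψ` pull back
primitives of a cochain to cochains with the same circulation. -/
theorem circulation_eq_of_comp_eq {Y Z : Type*} [TopologicalSpace Y] [TopologicalSpace Z]
    {C : Cochain R X 2} {Φ : C(Y, X)} {Ψ : C(Z, X)} {b : Cochain R Y 1} {b' : Cochain R Z 1}
    (hb : d R _ 1 b = cochainPullback R Φ 2 C) (hb' : d R _ 1 b' = cochainPullback R Ψ 2 C)
    {p : C(ℝ × ℝ, Y)} {q : C(ℝ × ℝ, Z)} (h : Φ.comp p = Ψ.comp q) (v w : ℝ × ℝ) :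
    circulation (cochainPullback R p 1 b) v w = circulation (cochainPullback R q 1 b') v w := by
  -- `b` and `b'` live on different spaces, but on the plane both become primitives of the same
  -- cochain.
  have h0 : d R _ 1 (cochainPullback R p 1 b - cochainPullback R q 1 b') = 0 := by
    rw [map_sub, d_cochainPullback, d_cochainPullback, hb, hb', sub_eq_zero]
    funext τ
    refine congrArg C ?_
    rw [← ContinuousMap.comp_assoc, h, ContinuousMap.comp_assoc]
  have h1 := circulation_eq_zero h0 v w
  simp only [circulation, Pi.sub_apply] at h1 ⊢
  linear_combination h1

/-- The two vertical sides cancel by `hb`, leaving the horizontal ones. -/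
theorem circulation_squareMap {b : Cochain R (ℝ × ℝ) 1}
    (hb : ∀ y y', b (edge (1, y) (1, y')) = b (edge (0, y) (0, y'))) (a ε : ℝ) :
    circulation (cochainPullback R (squareMap a ε) 1 b) (1, 0) (0, 1) =
      b (edge (0, a) (1, a)) - b (edge (0, a + ε) (1, a + ε)) := by
  have h (x y : ℝ × ℝ) (hx : x.1 ∈ I ∧ x.2 ∈ I) (hy : y.1 ∈ I ∧ y.2 ∈ I) :
      cochainPullback R (squareMap a ε) 1 b (edge x y) =
        b (edge (x.1, a + ε * x.2) (y.1, a + ε * y.2)) :=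
    congrArg b (squareMap_comp_edge a ε hx hy)
  rw [circulation, h _ _ (by simp) (by simp), h _ _ (by simp) (by simp), h _ _ (by simp) (by simp),
    h _ _ (by simp) (by simp)]
  simp only [Prod.fst_zero, Prod.snd_zero, Prod.mk_add_mk, mul_zero, mul_one, add_zero, zero_add, hb]
  ring

/-- The linear map of the plane with columns `v` and `w`. -/
def columns (v w : ℝ × ℝ) : C(ℝ × ℝ, ℝ × ℝ) := ⟨fun p => p.1 • v + p.2 • w, by fun_prop⟩

theorem circulation_columns (b : Cochain R (ℝ × ℝ) 1) (v w : ℝ × ℝ) :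
    circulation (cochainPullback R ((columns v w).comp (squareMap 0 1)) 1 b) (1, 0) (0, 1) =
      circulation b v w := by
  have h (x y : ℝ × ℝ) (hx : x.1 ∈ I ∧ x.2 ∈ I) (hy : y.1 ∈ I ∧ y.2 ∈ I) :
      cochainPullback R ((columns v w).comp (squareMap 0 1)) 1 b (edge x y) =
        b (edge (columns v w x) (columns v w y)) := by
    refine congrArg b ?_
    rw [ContinuousMap.comp_assoc, squareMap_comp_edge 0 1 hx hy]
    ext1 t
    change (t.1 0 * x.1 + t.1 1 * y.1) • v + (t.1 0 * (0 + 1 * x.2) + t.1 1 * (0 + 1 * y.2)) • w =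
      t.1 0 • (x.1 • v + x.2 • w) + t.1 1 • (y.1 • v + y.2 • w)
    module
  rw [circulation, h _ _ (by simp) (by simp), h _ _ (by simp) (by simp), h _ _ (by simp) (by simp),
    h _ _ (by simp) (by simp)]
  simp [circulation, columns]

/-- A doubly periodic map of the plane on a strip, capped off by a null-homotopy on either side. -/
def capped (Φ : C(ℝ × ℝ, X)) (v w : ℝ × ℝ) (hw : ∀ x, Φ (w + x) = Φ x) (K : C(I × I, X))
    (hK : ∀ s : I, K (0, s) = Φ ((s : ℝ) • v)) : C(ℝ × ℝ, X) where
  toFun p := if p.2 ≤ 0 then K (clamp (-p.2), clamp p.1) else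
    if p.2 ≤ 1 then Φ ((clamp p.1 : ℝ) • v + p.2 • w) else K (clamp (p.2 - 1), clamp p.1)
  continuous_toFun := by
    have := continuous_clamp
    have h0 : clamp 0 = 0 := clamp_coe (by simp)
    refine Continuous.if_le (by fun_prop) (Continuous.if_le (by fun_prop) (by fun_prop)
      (by fun_prop) (by fun_prop) fun p hp => ?_) (by fun_prop) (by fun_prop) fun p hp => ?_
    · rw [hp, one_smul, add_comm, hw, sub_self, h0, hK]
    · rw [hp, if_pos zero_le_one, neg_zero, h0, hK, zero_smul, add_zero]

/-- On the capped sphere take a primitive of the pullback of `C`. By periodicity in longitude, the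
circulation over the strip is the difference of its values on the two parallels bounding the strip.
The caps are mirror images in `X`, so the two parallel-to-pole differences agree; the values at the
poles agree as well, because both poles map to `x₀`. Hence the circulation vanishes. -/
theorem circulation_eq_zero_of_nullhomotopy {C : Cochain R X 2}
    (hC : ∀ g : C(S2, X), ∃ b, d R _ 1 b = cochainPullback R g 2 C)
    (Φ : C(ℝ × ℝ, X)) (v w : ℝ × ℝ) (hv : ∀ x, Φ (v + x) = Φ x) (hw : ∀ x, Φ (w + x) = Φ x)
    (K : C(I × I, X)) (hK : ∀ s : I, K (0, s) = Φ ((s : ℝ) • v)) (x₀ : X)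
    (hK1 : ∀ s, K (1, s) = x₀) (hK' : ∀ t, K (t, 0) = x₀) (hK'' : ∀ t, K (t, 1) = x₀)
    {b : Cochain R (ℝ × ℝ) 1} (hb : d R _ 1 b = cochainPullback R Φ 2 C) :
    circulation b v w = 0 := by
  have c0 : clamp 0 = 0 := clamp_coe (by simp)
  have c1 : clamp 1 = 1 := clamp_coe (by simp)
  let G := capped Φ v w hw K hK
  have G_low (s t : ℝ) (ht : t ≤ 0) : G (s, t) = K (clamp (-t), clamp s) := if_pos ht
  have G_high (s t : ℝ) (ht : 1 ≤ t) : G (s, t) = K (clamp (t - 1), clamp s) := by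
    rcases ht.eq_or_lt with rfl | ht
    · refine (if_neg (by norm_num)).trans ((if_pos le_rfl).trans ?_)
      dsimp only
      rw [one_smul, add_comm, hw, sub_self, c0, hK]
    · exact (if_neg (by dsimp only; linarith)).trans (if_neg (by dsimp only; linarith))
  have G_mid (s t : ℝ) (ht : t ∈ I) : G (s, t) = Φ ((clamp s : ℝ) • v + t • w) := by
    rcases ht.1.eq_or_lt with rfl | h
    · rw [G_low s 0 le_rfl, neg_zero, c0, hK, zero_smul, add_zero]
    · exact (if_neg (by dsimp only; linarith)).trans (if_pos ht.2)
  have G_per (t : ℝ) : G (0, t) = G (1, t) := by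
    rcases le_total t 0 with h | h
    · rw [G_low _ _ h, G_low _ _ h, c0, c1, hK', hK'']
    rcases le_total t 1 with h1 | h1
    · rw [G_mid _ _ ⟨h, h1⟩, G_mid _ _ ⟨h, h1⟩, c0, c1]
      simp [hv]
    · rw [G_high _ _ h1, G_high _ _ h1, c0, c1, hK', hK'']
  have G_bot (s : ℝ) : G (s, -1) = x₀ := by
    rw [G_low _ _ (by norm_num), neg_neg, c1, hK1]
  have G_top (s : ℝ) : G (s, 2) = x₀ := by
    rw [G_high _ _ (by norm_num), show (2 : ℝ) - 1 = 1 by norm_num, c1, hK1]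
  -- Heights from `-1` to `2` are rescaled to the unit interval: lower cap, strip and upper cap take
  -- one third each.
  obtain ⟨g, hg⟩ := exists_descend_sphere
    (G.comp ⟨fun p : I × I => ((p.1 : ℝ), 3 * (p.2 : ℝ) - 1), by fun_prop⟩)
    (fun t => G_per _)
    (fun s => by
      change G ((s : ℝ), 3 * (0 : ℝ) - 1) = G ((0 : ℝ), 3 * (0 : ℝ) - 1)
      rw [show 3 * (0 : ℝ) - 1 = -1 by norm_num, G_bot, G_bot])
    (fun s => by
      change G ((s : ℝ), 3 * (1 : ℝ) - 1) = G ((0 : ℝ), 3 * (1 : ℝ) - 1)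
      rw [show 3 * (1 : ℝ) - 1 = 2 by norm_num, G_top, G_top])
  obtain ⟨b₁, hb₁⟩ := hC g
  let Q : C(ℝ × ℝ, S2) := spherical.comp ⟨fun p => (p.1, (p.2 + 1) / 3), by fun_prop⟩
  have hgQ (s t : ℝ) (hs : s ∈ I) (ht : t ∈ Set.Icc (-1 : ℝ) 2) : g (Q (s, t)) = G (s, t) := by
    refine (hg (⟨s, hs⟩, ⟨(t + 1) / 3, by linarith [ht.1], by linarith [ht.2]⟩)).trans ?_
    refine congrArg G (Prod.ext rfl ?_)
    change 3 * ((t + 1) / 3) - 1 = t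
    ring
  have hQ : d R _ 1 (cochainPullback R Q 1 b₁) = cochainPullback R (g.comp Q) 2 C := by
    rw [d_cochainPullback, hb₁]; rfl
  have hper (y y' : ℝ) : cochainPullback R Q 1 b₁ (edge (1, y) (1, y')) =
      cochainPullback R Q 1 b₁ (edge (0, y) (0, y')) := by
    have e : edge ((1 : ℝ), y) (1, y') = (shift (1, 0)).comp (edge (0, y) (0, y')) := by
      rw [shift_comp_edge]; simp
    rw [e]
    refine congrArg b₁ (ContinuousMap.ext fun t => ?_)
    refine Eq.trans (congrArg spherical ?_) (spherical_add_one _ _)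
    exact Prod.ext (add_comm _ _) (congrArg (fun z : ℝ => (z + 1) / 3) (zero_add _))
  have hcap (y : ℝ) (P : S2) (hP : ∀ s, Q (s, y) = P) :
      cochainPullback R Q 1 b₁ (edge (0, y) (1, y)) = C (pt 2 (g P)) := by
    refine Eq.trans ?_ (apply_pt_of_d_eq hb₁ P)
    refine congrArg b₁ (ContinuousMap.ext fun t => ?_)
    have h := stdSimplex.sum_eq_one t
    rw [Fin.sum_univ_two] at h
    have e : edge (0, y) (1, y) t = ((edge (0, y) (1, y) t).1, y) := by
      refine Prod.ext rfl ?_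
      change t 0 * y + t 1 * y = y
      rw [← add_mul, h, one_mul]
    change Q (edge (0, y) (1, y) t) = P
    rw [e, hP]
  have mem1 (x : I) : (0 + 1 * (x : ℝ)) ∈ I := by simp
  have hmid := circulation_eq_of_comp_eq hQ hb
    (p := squareMap 0 1) (q := (columns v w).comp (squareMap 0 1))
    (ContinuousMap.ext fun x => by
      change g (Q (clamp x.1, 0 + 1 * clamp x.2)) =
        Φ ((clamp x.1 : ℝ) • v + (0 + 1 * (clamp x.2 : ℝ)) • w)
      rw [hgQ _ _ (clamp x.1).2 ⟨by linarith [(mem1 (clamp x.2)).1],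
        by linarith [(mem1 (clamp x.2)).2]⟩, G_mid _ _ (mem1 _), clamp_coe (clamp x.1).2])
    (1, 0) (0, 1)
  -- The factor `-1` runs down the lower cap while the other square runs up the upper one; both
  -- trace the same `K`.
  have hends := circulation_eq_of_comp_eq hQ hQ (p := squareMap 0 (-1)) (q := squareMap 1 1)
    (ContinuousMap.ext fun x => by
      change g (Q (clamp x.1, 0 + -1 * clamp x.2)) = g (Q (clamp x.1, 1 + 1 * clamp x.2))
      have m1 := (clamp x.2).2.1
      have m2 := (clamp x.2).2.2
      rw [hgQ _ _ (clamp x.1).2 ⟨by linarith, by linarith⟩,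
        hgQ _ _ (clamp x.1).2 ⟨by linarith, by linarith⟩, G_low _ _ (by linarith),
        G_high _ _ (by linarith)]
      congr 3
      ring)
    (1, 0) (0, 1)
  rw [circulation_columns, circulation_squareMap hper] at hmid
  rw [circulation_squareMap hper, circulation_squareMap hper] at hends
  have hN : ∀ s, Q (s, -1) = spherical (0, 0) := fun s => by
    change spherical (s, (-1 + 1) / 3) = _
    rw [show ((-1 : ℝ) + 1) / 3 = 0 by norm_num, spherical_zero]
  have hS : ∀ s, Q (s, 2) = spherical (0, 1) := fun s => by
    change spherical (s, (2 + 1) / 3) = _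
    rw [show ((2 : ℝ) + 1) / 3 = 1 by norm_num, spherical_one]
  have hNS : g (spherical (0, 0)) = g (spherical (0, 1)) := by
    rw [← hN 0, ← hS 0, hgQ _ _ (by simp) (by norm_num), hgQ _ _ (by simp) (by norm_num), G_bot,
      G_top]
  have hlow := hcap (-1) _ hN
  have hhigh := hcap 2 _ hS
  rw [zero_add, one_add_one_eq_two, hlow, hhigh, hNS] at hends
  rw [zero_add] at hmid
  linear_combination hends - hmid

end Gluing


open unitInterval Topology

/-! ### Path-connectedness and the homomorphism from `ℤ²` to the fundamental group. -/

section Path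

variable {X : Type*} [TopologicalSpace X]

/-- A connected CW complex is path connected. -/
theorem pathConnectedSpace_of_cwComplex [T2Space X] [ConnectedSpace X]
    [CWComplex (Set.univ : Set X)] : PathConnectedSpace X := by
  have hcell (n : ℕ) (j : RelCWComplex.cell (Set.univ : Set X) n) :
      IsPathConnected (RelCWComplex.closedCell n j) :=
    ((convex_closedBall (0 : Fin n → ℝ) 1).isPathConnected
      ⟨0, Metric.mem_closedBall_self zero_le_one⟩).image' (RelCWComplex.continuousOn n j)
  -- A union of path components meets each closed cell in all of it or not at all, so it is closed
  -- in the weak topology.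
  have hclosed (A : Set X) (hA : ∀ x y, Joined x y → x ∈ A → y ∈ A) : IsClosed A := by
    rw [CWComplex.closed Set.univ A (Set.subset_univ _)]
    intro n j
    by_cases h : (A ∩ RelCWComplex.closedCell n j).Nonempty
    · obtain ⟨x, hx, hxj⟩ := h
      have : A ∩ RelCWComplex.closedCell n j = RelCWComplex.closedCell n j :=
        Set.inter_eq_right.2 fun y hy => hA x y ((hcell n j).joinedIn x hxj y hy).joined hx
      rw [this]
      exact RelCWComplex.isClosed_closedCell
    · rw [Set.not_nonempty_iff_eq_empty.1 h]
      exact isClosed_empty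
  obtain ⟨x⟩ := (inferInstance : Nonempty X)
  have hclopen : IsClopen (pathComponent x) :=
    ⟨hclosed _ fun y z h hy => Joined.trans hy h,
      isClosed_compl_iff.1 (hclosed _ fun y z h hy hz => hy (Joined.trans hz h.symm))⟩
  have huniv := hclopen.eq_univ ⟨x, Joined.refl x⟩
  refine ⟨⟨x⟩, fun y z => ?_⟩
  have hy : y ∈ pathComponent x := huniv ▸ Set.mem_univ y
  have hz : z ∈ pathComponent x := huniv ▸ Set.mem_univ z
  exact (Joined.symm hy).trans hz

/-- The segment between two points of the plane as a path. -/
def planePath (x y : ℝ × ℝ) : Path x y where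
  toFun s := (1 - (s : ℝ)) • x + (s : ℝ) • y
  source' := by simp
  target' := by simp

theorem apply_latticeVec {Φ : C(ℝ × ℝ, X)} (hΦ : ∀ v x, Φ (latticeVec v + x) = Φ x) (v : ℤ × ℤ) :
    Φ (latticeVec v) = Φ 0 := by
  rw [← hΦ v 0, add_zero]

/-- The loop in the direction of an integral vector in the image of a doubly periodic map. -/
def latticeLoop (Φ : C(ℝ × ℝ, X)) (hΦ : ∀ v x, Φ (latticeVec v + x) = Φ x) (v : ℤ × ℤ) :
    Path (Φ 0) (Φ 0) :=
  ((planePath 0 (latticeVec v)).map Φ.continuous).cast rfl (apply_latticeVec hΦ v).symm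

/-- By periodicity the second loop also lifts to the segment from `v` to `v + w`, and paths in the
simply connected plane with common endpoints are homotopic. -/
theorem latticeLoop_add (Φ : C(ℝ × ℝ, X)) (hΦ : ∀ v x, Φ (latticeVec v + x) = Φ x) (v w : ℤ × ℤ) :
    ((latticeLoop Φ hΦ v).trans (latticeLoop Φ hΦ w)).Homotopic (latticeLoop Φ hΦ (v + w)) := by
  have h1 : latticeLoop Φ hΦ w = ((planePath (latticeVec v) (latticeVec (v + w))).map
      Φ.continuous).cast (apply_latticeVec hΦ v).symm (apply_latticeVec hΦ (v + w)).symm := by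
    ext s
    change Φ ((1 - (s : ℝ)) • (0 : ℝ × ℝ) + (s : ℝ) • latticeVec w) =
      Φ ((1 - (s : ℝ)) • latticeVec v + (s : ℝ) • latticeVec (v + w))
    rw [latticeVec_add, ← hΦ v ((1 - (s : ℝ)) • (0 : ℝ × ℝ) + (s : ℝ) • latticeVec w)]
    congr 1
    module
  have h2 : ((planePath 0 (latticeVec v)).trans
      (planePath (latticeVec v) (latticeVec (v + w)))).Homotopic
        (planePath 0 (latticeVec (v + w))) := SimplyConnectedSpace.paths_homotopic _ _
  have h3 := (h2.map Φ).pathCast rfl (apply_latticeVec hΦ (v + w)).symm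
  convert h3 using 1
  swap
  · rfl
  rw [h1, Path.map_trans]
  ext s
  simp only [latticeLoop, Path.trans_apply, Path.cast_coe]

/-- The homomorphism from `ℤ²` to the fundamental group induced by a doubly periodic map. -/
def latticeHom (Φ : C(ℝ × ℝ, X)) (hΦ : ∀ v x, Φ (latticeVec v + x) = Φ x) :
    Multiplicative (ℤ × ℤ) →* FundamentalGroup X (Φ 0) :=
  MonoidHom.mk' (fun v => FundamentalGroup.fromPath
    (Path.Homotopic.Quotient.mk (latticeLoop Φ hΦ v.toAdd))) fun v w => by
    -- Multiplication concatenates paths in the opposite order; commutativity of `ℤ²` absorbs this.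
    rw [FundamentalGroup.mul_def, toAdd_mul, add_comm]
    exact (Path.Homotopic.Quotient.eq.2 (latticeLoop_add Φ hΦ w.toAdd v.toAdd)).symm

/-- The circulation along a parallelogram vanishes if the loop along its first side is
null-homotopic. -/
theorem circulation_eq_zero_of_latticeHom_eq_one {R : Type*} [CommRing R] {C : Cochain R X 2}
    (hC : ∀ g : C(S2, X), ∃ b, d R _ 1 b = cochainPullback R g 2 C)
    (Φ : C(ℝ × ℝ, X)) (hΦ : ∀ v x, Φ (latticeVec v + x) = Φ x) {v : ℤ × ℤ}
    (hv : latticeHom Φ hΦ (.ofAdd v) = 1) (w : ℤ × ℤ)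
    {b : Cochain R (ℝ × ℝ) 1} (hb : d R _ 1 b = cochainPullback R Φ 2 C) :
    circulation b (latticeVec v) (latticeVec w) = 0 := by
  have h : Path.Homotopic.Quotient.mk (latticeLoop Φ hΦ v) =
    Path.Homotopic.Quotient.mk (Path.refl (Φ 0)) := hv
  obtain ⟨K⟩ := Path.Homotopic.Quotient.eq.1 h
  refine circulation_eq_zero_of_nullhomotopy hC Φ _ _ (hΦ v) (hΦ w) K.toContinuousMap
    (fun s => ?_) (Φ 0) (fun s => K.apply_one s) (fun t => K.source t) (fun t => K.target t) hb
  refine (K.apply_zero s).trans ?_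
  change Φ ((1 - (s : ℝ)) • (0 : ℝ × ℝ) + (s : ℝ) • latticeVec v) = _
  rw [smul_zero, zero_add]

end Path

/-! ### Conclusion for cohomology classes. -/

theorem pullback_mk_eq_zero_iff {R : Type*} [CommRing R] {Y Z : Type*} [TopologicalSpace Y]
    [TopologicalSpace Z] (f : C(Y, Z)) (n : ℕ) (c : cocycles R Z (n + 1)) :
    pullback R f (n + 1) (Submodule.Quotient.mk c) = 0 ↔
      ∃ b, d R Y n b = cochainPullback R f (n + 1) c := by
  exact Submodule.Quotient.mk_eq_zero _

/-- An aspherical class pulls back to zero under a map of the torus that kills, on fundamental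
groups, an integral vector spanning a parallelogram of invertible area. -/
theorem pullback_eq_zero_of_latticeHom_eq_one {X : Type*} [TopologicalSpace X] {F : Type*} [Field F]
    {u : H F X 2} (hu : IsAspherical u) (f : C(UnitAddTorus (Fin 2), X))
    (hΦ : ∀ v x, (f.comp torusCover) (latticeVec v + x) = f.comp torusCover x) {v : ℤ × ℤ}
    (hv : latticeHom (f.comp torusCover) hΦ (.ofAdd v) = 1) (w : ℤ × ℤ)
    (hvw : (v.1 * w.2 - v.2 * w.1 : F) ≠ 0) : pullback F f 2 u = 0 := by
  obtain ⟨c, rfl⟩ := Submodule.Quotient.mk_surjective _ u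
  have hc : d F X 2 c = 0 := c.2
  have hC (g : C(S2, X)) := (pullback_mk_eq_zero_iff g 1 c).1 (hu g)
  rw [pullback_mk_eq_zero_iff]
  obtain ⟨b, hb⟩ := exists_d_eq (cochainPullback F (f.comp torusCover) 2 (c : Cochain F X 2))
    (by rw [d_cochainPullback, hc, map_zero])
  exact exists_d_eq_of_det_ne_zero hb v w hvw
    (circulation_eq_zero_of_latticeHom_eq_one hC _ hΦ hv w hb)

end SingularCohomology
end

theorem mainTheorem6 {X : Type*} [TopologicalSpace X] [T2Space X] [ConnectedSpace X]
    [Topology.CWComplex (Set.univ : Set X)] {F : Type*} [Field F]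
    (u : SingularCohomology.H F X 2) (hu : SingularCohomology.IsAspherical u) (x₀ : X)
    (hZ2 : ¬ ∃ K : Subgroup (FundamentalGroup X x₀), Nonempty (K ≃* Multiplicative (ℤ × ℤ))) :
    (CharZero F → SingularCohomology.IsAtoroidal u) ∧
      ((∀ g : FundamentalGroup X x₀, IsOfFinOrder g → g = 1) →
        SingularCohomology.IsAtoroidal u) := by
  open SingularCohomology in
  have := pathConnectedSpace_of_cwComplex (X := X)
  have key (f : C(UnitAddTorus (Fin 2), X)) :
      ∃ hΦ : ∀ v x, (f.comp torusCover) (latticeVec v + x) = f.comp torusCover x,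
      ∃ v : ℤ × ℤ, v ≠ 0 ∧ latticeHom (f.comp torusCover) hΦ (.ofAdd v) = 1 := by
    refine ⟨fun v x => congrArg f (torusCover_add v x), ?_⟩
    by_contra! hne
    let e := FundamentalGroup.fundamentalGroupMulEquivOfPathConnected (f.comp torusCover 0) x₀
    let φ := e.toMonoidHom.comp
      (latticeHom (f.comp torusCover) fun v x => congrArg f (torusCover_add v x))
    have hφ : Function.Injective φ := by
      refine (injective_iff_map_eq_one φ).2 fun v hv => ?_
      by_contra h
      exact hne v.toAdd h (e.map_eq_one_iff.1 hv)
    exact hZ2 ⟨φ.range, ⟨(MonoidHom.ofInjective hφ).symm⟩⟩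
  refine ⟨fun _ f => ?_, fun htf f => ?_⟩
  · obtain ⟨hΦ, v, hv0, hv⟩ := key f
    -- The quarter turn of `v` spans with it a square of area `v.1 ^ 2 + v.2 ^ 2`, a nonzero
    -- integer.
    refine pullback_eq_zero_of_latticeHom_eq_one hu f hΦ hv (-v.2, v.1) ?_
    have h : v.1 * v.1 - v.2 * -v.2 ≠ 0 := fun h => by
      have h1 : v.1 * v.1 + v.2 * v.2 = 0 := by linarith
      exact hv0 (Prod.ext (mul_self_eq_zero.1 (by nlinarith)) (mul_self_eq_zero.1 (by nlinarith)))
    exact_mod_cast h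
  · obtain ⟨hΦ, v, hv0, hv⟩ := key f
    have hg : v.1.gcd v.2 ≠ 0 := fun h =>
      hv0 (Prod.ext (Int.gcd_eq_zero_iff.1 h).1 (Int.gcd_eq_zero_iff.1 h).2)
    obtain ⟨a, ha⟩ := Int.gcd_dvd_left v.1 v.2
    obtain ⟨b, hb⟩ := Int.gcd_dvd_right v.1 v.2
    -- The gcd multiple of `(a, b)` is `v`, which is killed, so the image of `(a, b)` has finite
    -- order.
    have hv' : latticeHom (f.comp torusCover) hΦ (.ofAdd (a, b)) = 1 := by
      let e := FundamentalGroup.fundamentalGroupMulEquivOfPathConnected (f.comp torusCover 0) x₀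
      refine e.map_eq_one_iff.1 (htf _ (isOfFinOrder_iff_pow_eq_one.2
        ⟨v.1.gcd v.2, Nat.pos_of_ne_zero hg, ?_⟩))
      rw [← map_pow, ← map_pow, ← ofAdd_nsmul]
      have : v.1.gcd v.2 • (a, b) = v := by
        ext
        · simpa using ha.symm
        · simpa using hb.symm
      rw [this, hv, map_one]
    -- The Bézout coefficients complete the primitive vector `(a, b)` to a parallelogram of area
    -- `1`, which is invertible in every characteristic.
    refine pullback_eq_zero_of_latticeHom_eq_one hu f hΦ hv' (-v.1.gcdB v.2, v.1.gcdA v.2) ?_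
    have hbez := Int.gcd_eq_gcd_ab v.1 v.2
    have h : a * v.1.gcdA v.2 - b * -v.1.gcdB v.2 = 1 := by
      have hg' : (v.1.gcd v.2 : ℤ) ≠ 0 := by exact_mod_cast hg
      refine mul_left_cancel₀ hg' ?_
      linear_combination -hbez - v.1.gcdA v.2 * ha - v.1.gcdB v.2 * hb
    have h' := congrArg (Int.cast : ℤ → F) h
    push_cast at h' ⊢
    rw [h']
    exact one_ne_zero
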